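/- For $x\in\mathbb R^N$ let $\operatorname{supp}(x)=\{i: x_i\neq 0\}$, let $\Sigma_k=\{x\in\mathbb R^N:\#\operatorname{supp}(x)\le k\}$, and let $\sigma_k(x)_1=\min_{z\in\Sigma_k}\|x-z\|_1$ be the best $k$-term approximation error in $\ell_1$. For an $n\times N$ real matrix $\Phi$ and an integer $s\ge 0$, let $\delta_s$ be the smallest $d\ge 0$ such that $(1-d)\|x\|_2^2\le\|\Phi x\|_2^2\le(1+d)\|x\|_2^2$ for all $x\in\Sigma_s$. Orthogonal Matching Pursuit with $M$ iterations, $\mathrm{OMP}_M(y)$, starts with $\Lambda^0=\emptyset$, $c^0=0$, $r^0=y\in\mathbb R^n$; for $\ell=0,\dots,M-1$ it puts $h^\ell=\Phi^{T}r^\ell$, chooses an index $j$ maximizing $|h^\ell_j|$ over $\{1,\dots,N\}$ (ties are broken arbitrarily), sets $\Lambda^{\ell+1}=\Lambda^\ell\cup\{j\}$, takes $c^{\ell+1}$ to be a minimizer of $\|y-\Phi z\|_2$ over all $z$ with $\operatorname{supp}(z)\subset\Lambda^{\ell+1}$, and sets $r^{\ell+1}=y-\Phi c^{\ell+1}$.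 The output is $c^M$. **Corollary.** Let $0<\delta\le 1$, let $k\ge 1$ be an integer, and put $\alpha=\lceil 16+15\delta\rceil$. Suppose that $$\delta_{2k}+(1+\delta)\,\delta_{2\alpha k}\le\delta .$$ Then, for every $x\in\mathbb R^N$ and every output $\mathrm{OMP}_{2(\alpha-1)k}(\Phi x)$ of the algorithm on the input $\Phi x$, $$\|\mathrm{OMP}_{2(\alpha-1)k}(\Phi x)-x\|_2\le C_2\,\frac{\sigma_k(x)_1}{\sqrt k},\qquad C_2=2(1+\delta)\bigl(\sqrt{11+20\delta}+1\bigr)+3 .$$ In other words, $(\Phi,\mathrm{OMP}_{2(\alpha-1)k})$ is $(2,1)$ instance optimal of order $k$ with constant $C_2$, where a pair $(\Phi,\Delta)$ with a decoder $\Delta:\mathbb R^n\to\mathbb R^N$ is called $(q,p)$ instance optimal of order $k$ with constant $C$ if $\|x-\Delta(\Phi x)\|_q\le C\,\sigma_k(x)_p/k^{1/p-1/q}$ for all $x\in\mathbb R^N$, with $\sigma_k(x)_p=\min_{z\in\Sigma_k}\|x-z\|_p$. -/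

import Mathlib

open scoped ENNReal Matrix

noncomputable section

namespace OMP

/-- The `ℓ_p` norm of a vector in `ℝ^d`. -/
def lpNorm {d : ℕ} (p : ℝ≥0∞) (v : Fin d → ℝ) : ℝ := ‖WithLp.toLp p v‖

/-- The support `{i : x i ≠ 0}` of a vector. -/
def supp {N : ℕ} (x : Fin N → ℝ) : Finset (Fin N) := Finset.univ.filter fun i => x i ≠ 0

/-- The set `Σ_k` of `k`-sparse vectors. -/
def sparseVectors (N k : ℕ) : Set (Fin N → ℝ) := {x | (supp x).card ≤ k}

/-- The best `k`-term approximation error `σ_k(x)_p`: the distance, in the `ℓ_p` norm, from `x`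
to the set of `k`-sparse vectors. -/
def bestTermError {N : ℕ} (k : ℕ) (p : ℝ≥0∞) (x : Fin N → ℝ) : ℝ :=
  sInf ((fun z => lpNorm p (x - z)) '' sparseVectors N k)

/-- `Φ` satisfies the two-sided restricted isometry inequality of order `s` with constant `d`. -/
def RIPWith {n N : ℕ} (Φ : Matrix (Fin n) (Fin N) ℝ) (s : ℕ) (d : ℝ) : Prop :=
  ∀ x ∈ sparseVectors N s,
    (1 - d) * lpNorm 2 x ^ 2 ≤ lpNorm 2 (Φ *ᵥ x) ^ 2 ∧
      lpNorm 2 (Φ *ᵥ x) ^ 2 ≤ (1 + d) * lpNorm 2 x ^ 2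

/-- The restricted isometry constant `δ_s` of `Φ`: the smallest `d ≥ 0` for which the restricted
isometry inequality of order `s` holds. -/
def ripConst {n N : ℕ} (Φ : Matrix (Fin n) (Fin N) ℝ) (s : ℕ) : ℝ :=
  sInf {d : ℝ | 0 ≤ d ∧ RIPWith Φ s d}

/-- `j` is an index at which `|h|` is maximal. -/
def IsArgmaxAbs {N : ℕ} (h : Fin N → ℝ) (j : Fin N) : Prop := ∀ i, |h i| ≤ |h j|

/-- `c` minimises `‖y - Φ z‖₂` among all vectors `z` with support in `S`. -/
def IsLeastSquaresOn {n N : ℕ} (Φ : Matrix (Fin n) (Fin N) ℝ) (y : Fin n → ℝ)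
    (S : Finset (Fin N)) (c : Fin N → ℝ) : Prop :=
  supp c ⊆ S ∧ ∀ z, supp z ⊆ S → lpNorm 2 (y - Φ *ᵥ c) ≤ lpNorm 2 (y - Φ *ᵥ z)

/-- `IsOMPState Φ y l S c`: Orthogonal Matching Pursuit with encoding matrix `Φ` and input `y` can,
after `l` iterations, have selected the index set `S` and computed the vector `c`. The residual
is `y - Φ c`. Ties in the choice of the new index are broken arbitrarily. -/
inductive IsOMPState {n N : ℕ} (Φ : Matrix (Fin n) (Fin N) ℝ) (y : Fin n → ℝ) :
    ℕ → Finset (Fin N) → (Fin N → ℝ) → Prop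
  | init : IsOMPState Φ y 0 ∅ 0
  | step {l : ℕ} {S : Finset (Fin N)} {c c' : Fin N → ℝ} {j : Fin N} :
      IsOMPState Φ y l S c →
      IsArgmaxAbs (Φᵀ *ᵥ (y - Φ *ᵥ c)) j →
      IsLeastSquaresOn Φ y (insert j S) c' →
      IsOMPState Φ y (l + 1) (insert j S) c'

/-- `c` is an output of `OMP_M` on the input `y`. -/
def IsOMPOutput {n N : ℕ} (Φ : Matrix (Fin n) (Fin N) ℝ) (M : ℕ) (y : Fin n → ℝ)
    (c : Fin N → ℝ) : Prop := ∃ S, IsOMPState Φ y M S c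

/-- `Δ` is a decoder that runs OMP with `M` iterations (with some way of breaking ties). -/
def IsOMPDecoder {n N : ℕ} (Φ : Matrix (Fin n) (Fin N) ℝ) (M : ℕ)
    (Δ : (Fin n → ℝ) → (Fin N → ℝ)) : Prop := ∀ y, IsOMPOutput Φ M y (Δ y)

/-- The pair `(Φ, Δ)` is `(q, p)` instance optimal of order `k` with constant `C`. -/
def InstanceOptimal {n N : ℕ} (Φ : Matrix (Fin n) (Fin N) ℝ) (Δ : (Fin n → ℝ) → (Fin N → ℝ))
    (q p : ℝ≥0∞) (k : ℕ) (C : ℝ) : Prop :=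
  ∀ x : Fin N → ℝ, lpNorm q (x - Δ (Φ *ᵥ x)) ≤
    C * (bestTermError k p x / (k : ℝ) ^ (1 / p.toReal - 1 / q.toReal))

end OMP

end

namespace OMP

variable {n N : ℕ}

/-! ### Euclidean norms and restrictions -/

/-! Put `U = 1 + δ_{2k}`, `L = 1 - δ_{2αk}`, `ρ = 1 + δ`; the hypothesis on `Φ` says exactly `U ≤ ρ
* L`. Split `x = u + w`, with `u` carrying the largest `2k` entries, and treat `e = Φ w` as noise.
Cutting `w` into blocks of length `k` gives `‖w‖₂ ≤ σ` and `‖e‖₂ ≤ √U σ`, where `σ = σ_k(x)_1 / √k`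
(`exists_restr_compl_le`).

The core is `IsOMPRun.res_le`: after `A * 2k` iterations the squared residual is at most `49 ‖e‖²`.
One iteration shrinks the excess over any competitor with `m` entries outside the selected set by
the factor `1 - 1/(ρ m)` (`IsLeastSquaresOn.res_step`), so `κ m` iterations leave at most `1/20` of
it. Competitors of sizes `1, 2, 4, ...` are used in successive phases. Either some phase selects
enough indices of the target to pay for its iterations, and induction on the number of missing
indices applies, or the large unselected entries keep the residual from falling by more than a
factor 10 per phase. The last competitor misses no entry, so its phase forces a greater fall: a
contradiction.

The lower isometry bound turns the residual bound into `‖c - u‖₂ ≤ 8ρσ`, and `8ρ + 1 ≤ C₂`. -/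

lemma lpNorm_two_sq {d : ℕ} (v : Fin d → ℝ) : lpNorm 2 v ^ 2 = v ⬝ᵥ v := by
  rw [lpNorm, EuclideanSpace.norm_sq_eq]
  simp [dotProduct, sq]

lemma lpNorm_two_nonneg {d : ℕ} (v : Fin d → ℝ) : 0 ≤ lpNorm 2 v := norm_nonneg _

lemma lpNorm_two_add_le {d : ℕ} (v w : Fin d → ℝ) :
    lpNorm 2 (v + w) ≤ lpNorm 2 v + lpNorm 2 w := by
  simp only [lpNorm, WithLp.toLp_add]
  exact norm_add_le _ _

lemma lpNorm_two_neg {d : ℕ} (v : Fin d → ℝ) : lpNorm 2 (-v) = lpNorm 2 v := by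
  simp [lpNorm]

lemma lpNorm_two_zero {d : ℕ} : lpNorm 2 (0 : Fin d → ℝ) = 0 := by
  simp [lpNorm]

lemma lpNorm_one_eq {d : ℕ} (v : Fin d → ℝ) : lpNorm 1 v = ∑ i, |v i| := by
  simp [lpNorm, PiLp.norm_eq_of_L1]

/-- The vector that agrees with `x` on `B` and vanishes elsewhere. -/
def restr (B : Finset (Fin N)) (x : Fin N → ℝ) : Fin N → ℝ := fun i => if i ∈ B then x i else 0

lemma supp_restr_subset (B : Finset (Fin N)) (x : Fin N → ℝ) : supp (restr B x) ⊆ B := by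
  intro i hi
  by_contra h
  simp [supp, restr, h] at hi

lemma restr_dotProduct_self (B : Finset (Fin N)) (x : Fin N → ℝ) :
    restr B x ⬝ᵥ restr B x = ∑ i ∈ B, x i ^ 2 := by
  simp [dotProduct, restr, sq, Finset.sum_ite_mem]

lemma restr_empty (x : Fin N → ℝ) : restr ∅ x = 0 := by
  ext i; simp [restr]

lemma restr_add_restr_sdiff {A B : Finset (Fin N)} (h : A ⊆ B) (x : Fin N → ℝ) :
    restr A x + restr (B \ A) x = restr B x := by
  ext i
  by_cases hA : i ∈ A
  · simp [restr, hA, h hA]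
  · simp [restr, hA]

lemma notMem_supp {x : Fin N → ℝ} {i : Fin N} : i ∉ supp x ↔ x i = 0 := by
  simp [supp]

lemma supp_sub_subset (x z : Fin N → ℝ) : supp (x - z) ⊆ supp x ∪ supp z := by
  intro i hi
  by_contra h
  rw [Finset.mem_union, not_or, notMem_supp, notMem_supp] at h
  simp [supp, h.1, h.2] at hi

lemma sub_dotProduct_self {d : ℕ} (u v : Fin d → ℝ) :
    (u - v) ⬝ᵥ (u - v) = u ⬝ᵥ u - 2 * (u ⬝ᵥ v) + v ⬝ᵥ v := by
  rw [sub_dotProduct, dotProduct_sub, dotProduct_sub, dotProduct_comm v u]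
  ring

/-- A weighted form of the parallelogram inequality. -/
lemma add_dotProduct_self_le {d : ℕ} (u v : Fin d → ℝ) :
    (u + v) ⬝ᵥ (u + v) ≤ 3 * (u ⬝ᵥ u) + 3 / 2 * (v ⬝ᵥ v) := by
  simp only [dotProduct, Finset.mul_sum, ← Finset.sum_add_distrib]
  refine Finset.sum_le_sum fun i _ => ?_
  simp only [Pi.add_apply]
  nlinarith [sq_nonneg (2 * u i - v i)]

/-! ### The restricted isometry constant -/

/-- Continuity of `Φ` supplies an admissible constant. This is needed because the real `sInf` of an
empty set is 0, which would make `ripConst` meaningless. -/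
lemma ripConst_set_nonempty (Φ : Matrix (Fin n) (Fin N) ℝ) (s : ℕ) :
    {d : ℝ | 0 ≤ d ∧ RIPWith Φ s d}.Nonempty := by
  obtain ⟨C, hC0, hC⟩ := (LinearMap.toContinuousLinearMap
    (Matrix.toLpLin 2 2 Φ : EuclideanSpace ℝ (Fin N) →ₗ[ℝ] EuclideanSpace ℝ (Fin n))).bound
  refine ⟨1 + C ^ 2, by positivity, fun x _ => ⟨?_, ?_⟩⟩
  · nlinarith [sq_nonneg (lpNorm 2 (Φ *ᵥ x)), mul_nonneg (sq_nonneg C) (sq_nonneg (lpNorm 2 x))]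
  · have h : lpNorm 2 (Φ *ᵥ x) ≤ C * lpNorm 2 x := hC (WithLp.toLp 2 x)
    have h2 := pow_le_pow_left₀ (lpNorm_two_nonneg _) h 2
    nlinarith [sq_nonneg (lpNorm 2 x)]

lemma ripConst_nonneg (Φ : Matrix (Fin n) (Fin N) ℝ) (s : ℕ) : 0 ≤ ripConst Φ s :=
  Real.sInf_nonneg fun _ hd => hd.1

/-- The infimum is attained: for fixed `x` both inequalities are closed conditions on `d`. -/
lemma ripWith_ripConst (Φ : Matrix (Fin n) (Fin N) ℝ) (s : ℕ) : RIPWith Φ s (ripConst Φ s) := by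
  have key : ∀ ε > 0, ∃ d < ripConst Φ s + ε, RIPWith Φ s d := fun ε hε => by
    obtain ⟨d, hd, hlt⟩ := exists_lt_of_csInf_lt (ripConst_set_nonempty Φ s)
      (lt_add_of_pos_right (ripConst Φ s) hε)
    exact ⟨d, hlt, hd.2⟩
  intro x hx
  have h0 := sq_nonneg (lpNorm 2 x)
  constructor
  · refine le_of_forall_pos_le_add fun ε hε => ?_
    obtain ⟨d, hd, hr⟩ := key (ε / (lpNorm 2 x ^ 2 + 1)) (by positivity)
    have h1 := (hr x hx).1
    have h2 : ε / (lpNorm 2 x ^ 2 + 1) * lpNorm 2 x ^ 2 ≤ ε := by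
      rw [div_mul_eq_mul_div, div_le_iff₀ (by positivity)]
      nlinarith
    nlinarith
  · refine le_of_forall_pos_le_add fun ε hε => ?_
    obtain ⟨d, hd, hr⟩ := key (ε / (lpNorm 2 x ^ 2 + 1)) (by positivity)
    have h1 := (hr x hx).2
    have h2 : ε / (lpNorm 2 x ^ 2 + 1) * lpNorm 2 x ^ 2 ≤ ε := by
      rw [div_mul_eq_mul_div, div_le_iff₀ (by positivity)]
      nlinarith
    nlinarith

/-! ### Runs of the algorithm -/

/-- The sequences of index sets and coefficient vectors of a run of `M` iterations. -/
structure IsOMPRun (Φ : Matrix (Fin n) (Fin N) ℝ) (y : Fin n → ℝ) (M : ℕ)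
    (S : ℕ → Finset (Fin N)) (c : ℕ → Fin N → ℝ) : Prop where
  zero : S 0 = ∅
  leastSquares : ∀ l ≤ M, IsLeastSquaresOn Φ y (S l) (c l)
  step : ∀ l < M, ∃ j, IsArgmaxAbs (Φᵀ *ᵥ (y - Φ *ᵥ c l)) j ∧ S (l + 1) = insert j (S l)

lemma isLeastSquaresOn_empty (Φ : Matrix (Fin n) (Fin N) ℝ) (y : Fin n → ℝ) :
    IsLeastSquaresOn Φ y ∅ 0 := by
  refine ⟨by simp [supp], fun z hz => ?_⟩
  have : z = 0 := by
    ext i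
    exact notMem_supp.1 fun h => by simpa using hz h
  rw [this]

/-- The inductive predicate remembers only the last state, whereas the residual estimates compare
different iterations of one run. -/
lemma IsOMPState.exists_run {Φ : Matrix (Fin n) (Fin N) ℝ} {y : Fin n → ℝ} {M : ℕ}
    {T : Finset (Fin N)} {b : Fin N → ℝ} (h : IsOMPState Φ y M T b) :
    ∃ S c, IsOMPRun Φ y M S c ∧ S M = T ∧ c M = b := by
  induction h with
  | init =>
    exact ⟨fun _ => ∅, fun _ => 0, ⟨rfl, fun _ _ => isLeastSquaresOn_empty Φ y,
      fun l hl => absurd hl (Nat.not_lt_zero l)⟩, rfl, rfl⟩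
  | @step m T b b' j _ hj hb ih =>
    obtain ⟨S, c, hr, rfl, rfl⟩ := ih
    refine ⟨Function.update S (m + 1) (insert j (S m)), Function.update c (m + 1) b',
      ⟨?_, fun l hl => ?_, fun l hl => ?_⟩, by simp, by simp⟩
    · rw [Function.update_of_ne (by omega)]
      exact hr.zero
    · rcases Nat.lt_or_ge m l with h | h
      · obtain rfl : l = m + 1 := by omega
        simpa using hb
      · rw [Function.update_of_ne (by omega), Function.update_of_ne (by omega)]
        exact hr.leastSquares l h
    · rcases Nat.lt_or_ge l m with h | h
      · rw [Function.update_of_ne (by omega), Function.update_of_ne (by omega),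
          Function.update_of_ne (by omega)]
        exact hr.step l h
      · obtain rfl : l = m := by omega
        refine ⟨j, ?_, ?_⟩
        · rw [Function.update_of_ne (by omega)]
          exact hj
        · rw [Function.update_of_ne (by omega : l ≠ l + 1)]
          simp

/-! ### Decrease of the residual in one iteration -/

/-- The squared residual `‖y - Φ z‖₂²`. -/
def res (Φ : Matrix (Fin n) (Fin N) ℝ) (y : Fin n → ℝ) (z : Fin N → ℝ) : ℝ :=
  (y - Φ *ᵥ z) ⬝ᵥ (y - Φ *ᵥ z)

lemma dotProduct_self_nonneg {d : ℕ} (v : Fin d → ℝ) : 0 ≤ v ⬝ᵥ v := by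
  rw [← lpNorm_two_sq]; positivity

lemma res_nonneg (Φ : Matrix (Fin n) (Fin N) ℝ) (y : Fin n → ℝ) (z : Fin N → ℝ) :
    0 ≤ res Φ y z := dotProduct_self_nonneg _

lemma IsLeastSquaresOn.res_le {Φ : Matrix (Fin n) (Fin N) ℝ} {y : Fin n → ℝ}
    {S : Finset (Fin N)} {c : Fin N → ℝ} (h : IsLeastSquaresOn Φ y S c) {z : Fin N → ℝ}
    (hz : supp z ⊆ S) : res Φ y c ≤ res Φ y z := by
  rw [res, res, ← lpNorm_two_sq, ← lpNorm_two_sq]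
  exact pow_le_pow_left₀ (lpNorm_two_nonneg _) (h.2 z hz) 2

/-- Moving `c` along the `j`-th coordinate. -/
lemma res_add_single (Φ : Matrix (Fin n) (Fin N) ℝ) (y : Fin n → ℝ) (c : Fin N → ℝ) (j : Fin N)
    (t : ℝ) : res Φ y (c + Pi.single j t) = res Φ y c - 2 * t * (Φᵀ *ᵥ (y - Φ *ᵥ c)) j +
      (Φ *ᵥ Pi.single j t) ⬝ᵥ (Φ *ᵥ Pi.single j t) := by
  have h : (y - Φ *ᵥ c) ⬝ᵥ (Φ *ᵥ Pi.single j t) = t * (Φᵀ *ᵥ (y - Φ *ᵥ c)) j := by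
    rw [Matrix.dotProduct_mulVec, ← Matrix.mulVec_transpose, dotProduct_single, mul_comm]
  rw [res, res, Matrix.mulVec_add, ← sub_sub, sub_dotProduct_self, h]
  ring

lemma mulVec_single_dotProduct_self (Φ : Matrix (Fin n) (Fin N) ℝ) (j : Fin N) (t : ℝ) :
    (Φ *ᵥ Pi.single j t) ⬝ᵥ (Φ *ᵥ Pi.single j t) =
      t ^ 2 * ((Φ *ᵥ Pi.single j 1) ⬝ᵥ (Φ *ᵥ Pi.single j 1)) := by
  have : (Pi.single j t : Fin N → ℝ) = t • Pi.single j 1 := by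
    rw [← Pi.single_smul]; simp
  rw [this, Matrix.mulVec_smul, smul_dotProduct, dotProduct_smul, smul_eq_mul, smul_eq_mul]
  ring

lemma supp_single_subset (j : Fin N) (t : ℝ) : supp (Pi.single j t : Fin N → ℝ) ⊆ {j} := by
  intro i hi
  by_contra h
  simp only [Finset.mem_singleton] at h
  simp [supp, h] at hi

lemma supp_add_single_subset {S : Finset (Fin N)} {c : Fin N → ℝ} (hc : supp c ⊆ S) (j : Fin N)
    (t : ℝ) : supp (c + Pi.single j t) ⊆ insert j S := by
  intro i hi
  by_contra h
  rw [Finset.mem_insert, not_or] at h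
  have h1 : c i = 0 := notMem_supp.1 fun h' => h.2 (hc h')
  simp [supp, h.1, h1] at hi

lemma eq_zero_of_forall_quadratic_nonneg {a b : ℝ} (ha : 0 ≤ a)
    (h : ∀ t : ℝ, 0 ≤ -(2 * t * b) + t ^ 2 * a) : b = 0 := by
  -- The denominator `a + 1` instead of `a` also covers `a = 0`.
  have h2 := h (b / (a + 1))
  have h3 : -(2 * (b / (a + 1)) * b) + (b / (a + 1)) ^ 2 * a =
      -(b ^ 2 * (a + 2) / (a + 1) ^ 2) := by
    field_simp
    ring
  rw [h3] at h2
  by_contra hne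
  have : 0 < b ^ 2 * (a + 2) / (a + 1) ^ 2 := by positivity
  linarith

/-- The residual of a least squares solution is orthogonal to the selected columns. -/
lemma IsLeastSquaresOn.correlation_eq_zero {Φ : Matrix (Fin n) (Fin N) ℝ} {y : Fin n → ℝ}
    {S : Finset (Fin N)} {c : Fin N → ℝ} (h : IsLeastSquaresOn Φ y S c) {j : Fin N}
    (hj : j ∈ S) : (Φᵀ *ᵥ (y - Φ *ᵥ c)) j = 0 := by
  set b := (Φᵀ *ᵥ (y - Φ *ᵥ c)) j with hb
  set a := (Φ *ᵥ Pi.single j 1) ⬝ᵥ (Φ *ᵥ Pi.single j 1) with ha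
  have ha0 : 0 ≤ a := dotProduct_self_nonneg _
  have key : ∀ t : ℝ, 0 ≤ -(2 * t * b) + t ^ 2 * a := fun t => by
    have h0 : supp (c + Pi.single j t) ⊆ S := by
      simpa only [Finset.insert_eq_of_mem hj] using supp_add_single_subset h.1 j t
    have h1 := h.res_le h0
    rw [res_add_single, mulVec_single_dotProduct_self] at h1
    linarith
  exact eq_zero_of_forall_quadratic_nonneg ha0 key

/-- Decrease of the squared residual in one iteration, compared with a competitor `z` having at
most `m` entries outside the current index set. -/
lemma IsLeastSquaresOn.res_step {Φ : Matrix (Fin n) (Fin N) ℝ} {y : Fin n → ℝ}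
    {S : Finset (Fin N)} {c c' z : Fin N → ℝ} {j : Fin N} {U L ρ : ℝ} {m : ℕ}
    (hc : IsLeastSquaresOn Φ y S c) (hj : IsArgmaxAbs (Φᵀ *ᵥ (y - Φ *ᵥ c)) j)
    (hc' : IsLeastSquaresOn Φ y (insert j S) c') (hU0 : 0 < U) (hL0 : 0 < L) (hUL : U ≤ ρ * L)
    (hU : (Φ *ᵥ Pi.single j 1) ⬝ᵥ (Φ *ᵥ Pi.single j 1) ≤ U)
    (hL : L * ((z - c) ⬝ᵥ (z - c)) ≤ (Φ *ᵥ (z - c)) ⬝ᵥ (Φ *ᵥ (z - c)))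
    (hm : (supp z \ S).card ≤ m) (hm0 : 0 < m) (hq : res Φ y z ≤ res Φ y c) :
    res Φ y c' - res Φ y z ≤ (1 - 1 / (ρ * m)) * (res Φ y c - res Φ y z) := by
  set h := Φᵀ *ᵥ (y - Φ *ᵥ c) with hh
  set g := Φ *ᵥ (z - c) with hg
  set G := g ⬝ᵥ g with hG
  set D := res Φ y c - res Φ y z with hD
  have hm1 : (0 : ℝ) < m := by exact_mod_cast hm0
  have hρ : 0 < ρ := by
    by_contra hcon
    nlinarith
  have hG0 : 0 ≤ G := dotProduct_self_nonneg _
  have hDG : 2 * ((y - Φ *ᵥ c) ⬝ᵥ g) = D + G := by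
    have : y - Φ *ᵥ z = (y - Φ *ᵥ c) - g := by
      rw [hg, Matrix.mulVec_sub]; abel
    rw [hD, res, res, this, sub_dotProduct_self (y - Φ *ᵥ c) g]
    ring
  -- Selected indices drop out because the residual is orthogonal to their columns; elsewhere only
  -- the support of `z` contributes, since `c` vanishes off `S`.
  have hsum : (y - Φ *ᵥ c) ⬝ᵥ g = ∑ i ∈ supp z \ S, h i * (z - c) i := by
    rw [hg, Matrix.dotProduct_mulVec, ← Matrix.mulVec_transpose, ← hh, dotProduct]
    symm
    refine Finset.sum_subset (Finset.subset_univ _) fun i _ hi => ?_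
    by_cases hS : i ∈ S
    · rw [hh, hc.correlation_eq_zero hS, zero_mul]
    · have h1 : z i = 0 := notMem_supp.1 fun h' => hi (Finset.mem_sdiff.2 ⟨h', hS⟩)
      have h2 : c i = 0 := notMem_supp.1 fun h' => hS (hc.1 h')
      simp [h1, h2]
  have hcs : ((y - Φ *ᵥ c) ⬝ᵥ g) ^ 2 ≤ (m * h j ^ 2) * ((z - c) ⬝ᵥ (z - c)) := by
    rw [hsum]
    refine (Finset.sum_mul_sq_le_sq_mul_sq _ _ _).trans ?_
    refine mul_le_mul ?_ ?_ (Finset.sum_nonneg fun i _ => sq_nonneg _) (by positivity)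
    · calc ∑ i ∈ supp z \ S, h i ^ 2 ≤ ∑ i ∈ supp z \ S, h j ^ 2 :=
            Finset.sum_le_sum fun i _ => sq_le_sq.2 (hj i)
        _ = (supp z \ S).card * h j ^ 2 := by rw [Finset.sum_const, nsmul_eq_mul]
        _ ≤ m * h j ^ 2 := by gcongr
    · simp only [dotProduct, ← sq]
      exact Finset.sum_le_sum_of_subset_of_nonneg (Finset.subset_univ _) fun i _ _ => sq_nonneg _
  have hD0 : 0 ≤ D := sub_nonneg.2 hq
  -- As `2⟨r, g⟩ = D + G`, the bound `4 D G ≤ (D + G)²` lets the factor `G` cancel against the lower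
  -- isometry bound.
  have hamgm : 4 * (D * G) ≤ 4 * ((y - Φ *ᵥ c) ⬝ᵥ g) ^ 2 := by
    have : 4 * ((y - Φ *ᵥ c) ⬝ᵥ g) ^ 2 = (D + G) ^ 2 := by rw [← hDG]; ring
    rw [this]
    nlinarith [sq_nonneg (D - G)]
  have hLD : L * D ≤ m * h j ^ 2 := by
    have h1 : L * (D * G) ≤ (m * h j ^ 2) * G := by
      have h2 : L * ((y - Φ *ᵥ c) ⬝ᵥ g) ^ 2 ≤ (m * h j ^ 2) * (L * ((z - c) ⬝ᵥ (z - c))) := by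
        nlinarith
      have h3 := mul_le_mul_of_nonneg_left hL (by positivity : 0 ≤ m * h j ^ 2)
      nlinarith
    rcases hG0.eq_or_lt with h0 | h0
    · have : (z - c) ⬝ᵥ (z - c) = 0 := by
        refine le_antisymm ?_ (dotProduct_self_nonneg _)
        by_contra hcon
        have := mul_pos hL0 (not_le.1 hcon)
        linarith
      rw [this, mul_zero] at hcs
      have h4 : (y - Φ *ᵥ c) ⬝ᵥ g = 0 := by
        by_contra hne
        have : 0 < ((y - Φ *ᵥ c) ⬝ᵥ g) ^ 2 := by positivity
        linarith
      have : D = 0 := by rw [h4] at hDG; linarith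
      rw [this, mul_zero]
      positivity
    · refine le_of_mul_le_mul_right ?_ h0
      linarith
  -- The step length `h j / U` minimises the upper bound `-2 t (h j) + t² U` for the change of the
  -- squared residual.
  have hdec : res Φ y c' ≤ res Φ y c - h j ^ 2 / U := by
    have h1 := hc'.res_le (supp_add_single_subset hc.1 j (h j / U))
    rw [res_add_single, mulVec_single_dotProduct_self, ← hh] at h1
    have h2 := mul_le_mul_of_nonneg_left hU (sq_nonneg (h j / U))
    have h3 : (h j / U) ^ 2 * U = h j ^ 2 / U := by field_simp
    have h4 : 2 * (h j / U) * h j = 2 * (h j ^ 2 / U) := by field_simp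
    linarith
  have hfin : 1 / (ρ * m) * D ≤ h j ^ 2 / U := by
    rw [div_mul_eq_mul_div, one_mul, div_le_div_iff₀ (by positivity) hU0]
    calc D * U ≤ D * (ρ * L) := by gcongr
      _ = ρ * (L * D) := by ring
      _ ≤ ρ * (m * h j ^ 2) := by gcongr
      _ = h j ^ 2 * (ρ * m) := by ring
  have : res Φ y c' - res Φ y z = D - (res Φ y c - res Φ y c') := by rw [hD]; ring
  rw [this]
  linarith

/-- The weights suit `49 (v ⬝ᵥ v) < u ⬝ᵥ u`, when the right side is at most `8/7 + 8/49 = 64/49`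
times `u ⬝ᵥ u`. -/
lemma sub_dotProduct_self_le {d : ℕ} (u v : Fin d → ℝ) :
    (u - v) ⬝ᵥ (u - v) ≤ 8 / 7 * (u ⬝ᵥ u) + 8 * (v ⬝ᵥ v) := by
  simp only [dotProduct, Finset.mul_sum, ← Finset.sum_add_distrib]
  refine Finset.sum_le_sum fun i _ => ?_
  simp only [Pi.sub_apply]
  nlinarith [sq_nonneg (u i + 7 * v i)]

/-! ### Geometric decrease along a run -/

namespace IsOMPRun

variable {Φ : Matrix (Fin n) (Fin N) ℝ} {y : Fin n → ℝ} {M : ℕ} {S : ℕ → Finset (Fin N)}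
  {c : ℕ → Fin N → ℝ}

lemma subset_of_le (hr : IsOMPRun Φ y M S c) {l l' : ℕ} (h : l ≤ l') (h' : l' ≤ M) :
    S l ⊆ S l' := by
  induction l', h using Nat.le_induction with
  | base => exact Finset.Subset.refl _
  | succ i _ ih =>
    obtain ⟨j, _, hj⟩ := hr.step i h'
    rw [hj]
    exact (ih (by omega)).trans (Finset.subset_insert _ _)

lemma card_le (hr : IsOMPRun Φ y M S c) {l : ℕ} (h : l ≤ M) : (S l).card ≤ l := by
  induction l with
  | zero => simp [hr.zero]
  | succ i ih =>
    obtain ⟨j, _, hj⟩ := hr.step i h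
    rw [hj]
    exact (Finset.card_insert_le _ _).trans (Nat.succ_le_succ (ih (by omega)))

lemma res_anti (hr : IsOMPRun Φ y M S c) {l l' : ℕ} (h : l ≤ l') (h' : l' ≤ M) :
    res Φ y (c l') ≤ res Φ y (c l) :=
  (hr.leastSquares l' h').res_le
    (((hr.leastSquares l (h.trans h')).1).trans (hr.subset_of_le h h'))

/-- A geometric decrease of the residual towards that of a competitor with at most `m` entries
outside the current index set. -/
lemma res_add_le (hr : IsOMPRun Φ y M S c) {U L ρ : ℝ} {s m : ℕ} {z : Fin N → ℝ}
    (hU0 : 0 < U) (hL0 : 0 < L) (hρ : 1 ≤ ρ) (hUL : U ≤ ρ * L)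
    (hU : ∀ v : Fin N → ℝ, (supp v).card ≤ 1 → (Φ *ᵥ v) ⬝ᵥ (Φ *ᵥ v) ≤ U * (v ⬝ᵥ v))
    (hL : ∀ v : Fin N → ℝ, (supp v).card ≤ M + s → L * (v ⬝ᵥ v) ≤ (Φ *ᵥ v) ⬝ᵥ (Φ *ᵥ v))
    (hz : (supp z).card ≤ s) {l : ℕ} (hm : (supp z \ S l).card ≤ m) (hm0 : 0 < m) {i : ℕ}
    (hi : l + i ≤ M) :
    res Φ y (c (l + i)) ≤ res Φ y z + (1 - 1 / (ρ * m)) ^ i * res Φ y (c l) := by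
  have hm1 : (1 : ℝ) ≤ m := by exact_mod_cast hm0
  have hρm : 1 ≤ ρ * m := by nlinarith
  have hθ : 0 ≤ 1 - 1 / (ρ * m) := by
    rw [sub_nonneg, div_le_one (by positivity)]
    exact hρm
  induction i with
  | zero => simpa using res_nonneg Φ y z
  | succ i ih =>
    have hpos := mul_nonneg (pow_nonneg hθ (i + 1)) (res_nonneg Φ y (c l))
    -- Once the residual is below that of `z`, monotonicity suffices; `res_step` needs the opposite
    -- order.
    rcases le_total (res Φ y (c (l + i))) (res Φ y z) with h | h
    · have := hr.res_anti (Nat.le_succ (l + i)) hi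
      rw [← add_assoc]
      exact (this.trans h).trans (le_add_of_nonneg_right hpos)
    · obtain ⟨j, hj, hS⟩ := hr.step (l + i) hi
      have h1 := (hr.leastSquares (l + i) (by omega)).res_step (c' := c (l + i + 1)) (z := z)
        (m := m) hj (hS ▸ hr.leastSquares (l + i + 1) hi) hU0 hL0 hUL ?_ ?_ ?_ hm0 h
      · have h2 := mul_le_mul_of_nonneg_left (sub_le_iff_le_add'.2 (ih (by omega))) hθ
        rw [← add_assoc, pow_succ']
        linarith
      · have := hU (Pi.single j 1)
          ((Finset.card_le_card (supp_single_subset j 1)).trans (by simp))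
        simpa using this
      · refine hL _ ?_
        have h3 := Finset.card_le_card (supp_sub_subset z (c (l + i)))
        have h4 := Finset.card_union_le (supp z) (supp (c (l + i)))
        have h5 := Finset.card_le_card (hr.leastSquares (l + i) (by omega)).1
        have h6 := hr.card_le (l := l + i) (by omega)
        omega
      · exact (Finset.card_le_card (Finset.sdiff_subset_sdiff le_rfl
          (hr.subset_of_le (by omega) (by omega)))).trans hm

/-- The power is at most `exp (-κ/ρ) ≤ exp (-3)`, and `exp 3 > 20`. -/
lemma one_sub_pow_le {ρ : ℝ} {m κ : ℕ} (hρ : 1 ≤ ρ) (hm : 0 < m) (hκ : 3 * ρ ≤ κ) :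
    (1 - 1 / (ρ * m)) ^ (κ * m) ≤ 1 / 20 := by
  have hm1 : (1 : ℝ) ≤ m := by exact_mod_cast hm
  have hρm : 1 ≤ ρ * m := by nlinarith
  have hθ : 0 ≤ 1 - 1 / (ρ * m) := by
    rw [sub_nonneg, div_le_one (by positivity)]
    exact hρm
  have h1 : 1 - 1 / (ρ * m) ≤ Real.exp (-(1 / (ρ * m))) := Real.one_sub_le_exp_neg _
  calc (1 - 1 / (ρ * m)) ^ (κ * m) ≤ Real.exp (-(1 / (ρ * m))) ^ (κ * m) := by gcongr
    _ = Real.exp (-(κ / ρ)) := by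
      rw [← Real.exp_nat_mul]
      congr 1
      push_cast
      field_simp
    _ ≤ Real.exp (-3) := by
      rw [Real.exp_le_exp, neg_le_neg_iff, le_div_iff₀ (by positivity)]
      exact hκ
    _ ≤ 1 / 20 := by
      rw [Real.exp_neg, ← one_div]
      refine one_div_le_one_div_of_le (by norm_num) ?_
      have h2 : Real.exp 3 = Real.exp 1 ^ 3 := by rw [← Real.exp_nat_mul]; norm_num
      have h3 := Real.exp_one_gt_d9
      rw [h2]
      calc (20 : ℝ) ≤ 2.7182818283 ^ 3 := by norm_num
        _ ≤ _ := by gcongr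

end IsOMPRun

/-! ### Reduction of the residual to noise level -/

/-- Among the subsets of `V` with at most `m` elements there is one with minimal tail sum. -/
lemma exists_min_tail {ι : Type*} [DecidableEq ι] (V : Finset ι) (f : ι → ℝ) (m : ℕ) :
    ∃ B ⊆ V, B.card ≤ m ∧
      ∀ B' ⊆ V, B'.card ≤ m → ∑ i ∈ V \ B, f i ≤ ∑ i ∈ V \ B', f i := by
  obtain ⟨B, hB, hmin⟩ := (V.powerset.filter fun B => B.card ≤ m).exists_min_image
    (fun B => ∑ i ∈ V \ B, f i) ⟨∅, by simp⟩
  simp only [Finset.mem_filter, Finset.mem_powerset] at hB hmin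
  exact ⟨B, hB.1, hB.2, fun B' h h' => hmin B' ⟨h, h'⟩⟩

namespace IsOMPRun

variable {Φ : Matrix (Fin n) (Fin N) ℝ} {M : ℕ} {S : ℕ → Finset (Fin N)}
  {c : ℕ → Fin N → ℝ}

/-- The energy of `x` off the selected indices is controlled by the residual. -/
lemma tail_le {x : Fin N → ℝ} {e : Fin n → ℝ} (hr : IsOMPRun Φ (Φ *ᵥ x + e) M S c) {L : ℝ}
    {s : ℕ} {T : Finset (Fin N)} (hL0 : 0 < L)
    (hL : ∀ v : Fin N → ℝ, (supp v).card ≤ M + s → L * (v ⬝ᵥ v) ≤ (Φ *ᵥ v) ⬝ᵥ (Φ *ᵥ v))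
    (hx : (supp x).card ≤ s) {i : ℕ} (hi : i ≤ M)
    (he : 49 * (e ⬝ᵥ e) < res Φ (Φ *ᵥ x + e) (c i)) :
    L * ∑ a ∈ T \ S i, x a ^ 2 ≤ 64 / 49 * res Φ (Φ *ᵥ x + e) (c i) := by
  have h1 : ∑ a ∈ T \ S i, x a ^ 2 ≤ (x - c i) ⬝ᵥ (x - c i) := by
    calc ∑ a ∈ T \ S i, x a ^ 2 = ∑ a ∈ T \ S i, (x - c i) a ^ 2 := by
          refine Finset.sum_congr rfl fun a ha => ?_
          have : c i a = 0 := notMem_supp.1 fun h =>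
            (Finset.mem_sdiff.1 ha).2 ((hr.leastSquares i hi).1 h)
          simp [this]
      _ ≤ ∑ a, (x - c i) a ^ 2 :=
          Finset.sum_le_sum_of_subset_of_nonneg (Finset.subset_univ _) fun _ _ _ => sq_nonneg _
      _ = _ := by simp only [dotProduct, sq]
  have h2 := hL (x - c i) (by
    have h3 := Finset.card_le_card (supp_sub_subset x (c i))
    have h4 := Finset.card_union_le (supp x) (supp (c i))
    have h5 := Finset.card_le_card (hr.leastSquares i hi).1
    have h6 := hr.card_le hi
    omega)
  have h3 : Φ *ᵥ (x - c i) = (Φ *ᵥ x + e - Φ *ᵥ c i) - e := by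
    rw [Matrix.mulVec_sub]; abel
  have h4 := sub_dotProduct_self_le (Φ *ᵥ x + e - Φ *ᵥ c i) e
  rw [← h3] at h4
  rw [res] at he ⊢
  have h5 := mul_le_mul_of_nonneg_left h1 hL0.le
  linarith

/-- The residual of the competitor obtained by dropping the entries in `D`. -/
lemma res_restr_sdiff_le {x : Fin N → ℝ} {e : Fin n → ℝ} {U : ℝ} {s : ℕ} {T D : Finset (Fin N)}
    (hU : ∀ v : Fin N → ℝ, (supp v).card ≤ s → (Φ *ᵥ v) ⬝ᵥ (Φ *ᵥ v) ≤ U * (v ⬝ᵥ v))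
    (hT : T.card ≤ s) (hx : supp x ⊆ T) (hD : D ⊆ T) :
    res Φ (Φ *ᵥ x + e) (restr (T \ D) x) ≤
      3 * (e ⬝ᵥ e) + 3 / 2 * (U * ∑ a ∈ D, x a ^ 2) := by
  have h1 : restr T x = x := by
    ext a
    by_cases h : a ∈ T
    · simp [restr, h]
    · simp [restr, h, notMem_supp.1 fun h' => h (hx h')]
  have h2 := restr_add_restr_sdiff hD x
  rw [h1] at h2
  have h3 : Φ *ᵥ x + e - Φ *ᵥ restr (T \ D) x = e + Φ *ᵥ restr D x := by
    have : Φ *ᵥ x = Φ *ᵥ restr D x + Φ *ᵥ restr (T \ D) x := by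
      rw [← Matrix.mulVec_add, h2]
    rw [this]; abel
  have h4 := hU (restr D x) ((Finset.card_le_card ((supp_restr_subset D x).trans hD)).trans hT)
  rw [restr_dotProduct_self] at h4
  have h5 := add_dotProduct_self_le e (Φ *ᵥ restr D x)
  rw [res, h3]
  linarith

/-- Orthogonal matching pursuit reduces the squared residual to a multiple of the noise energy
once the number of iterations is `A` times the sparsity. -/
theorem res_le {x : Fin N → ℝ} {e : Fin n → ℝ} (hr : IsOMPRun Φ (Φ *ᵥ x + e) M S c)
    {U L ρ : ℝ} {s κ A : ℕ} {T : Finset (Fin N)}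
    (hU0 : 0 < U) (hL0 : 0 < L) (hρ : 1 ≤ ρ) (hρ2 : ρ ≤ 2) (hUL : U ≤ ρ * L) (hs : 1 ≤ s)
    (hU : ∀ v : Fin N → ℝ, (supp v).card ≤ s → (Φ *ᵥ v) ⬝ᵥ (Φ *ᵥ v) ≤ U * (v ⬝ᵥ v))
    (hL : ∀ v : Fin N → ℝ, (supp v).card ≤ M + s → L * (v ⬝ᵥ v) ≤ (Φ *ᵥ v) ⬝ᵥ (Φ *ᵥ v))
    (hT : T.card ≤ s) (hx : supp x ⊆ T) (hκ : 3 * ρ ≤ κ) (hκA : 4 * κ ≤ A) {l : ℕ}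
    (hl : l + A * (T \ S l).card ≤ M) :
    res Φ (Φ *ᵥ x + e) (c M) ≤ 49 * (e ⬝ᵥ e) := by
  induction ht : (T \ S l).card using Nat.strong_induction_on generalizing l with
  | _ t IH =>
  -- Residuals decrease along the run, so if the last one exceeds `49 ‖e‖²` then all do, and noise
  -- terms can be absorbed throughout.
  by_contra! hcon
  rw [ht] at hl
  set R : ℕ → ℝ := fun i => res Φ (Φ *ᵥ x + e) (c i) with hR
  have hnoise : ∀ i ≤ M, 49 * (e ⬝ᵥ e) < R i := fun i hi =>
    hcon.trans_le (hr.res_anti hi le_rfl)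
  have he0 : 0 ≤ e ⬝ᵥ e := dotProduct_self_nonneg e
  have hxs : (supp x).card ≤ s := (Finset.card_le_card hx).trans hT
  have hlM : l ≤ M := by
    have := Nat.zero_le (A * t)
    omega
  set V := T \ S l with hV
  have hVT : V ⊆ T := Finset.sdiff_subset
  choose B hBV hBc hBmin using fun m => exists_min_tail V (fun a => x a ^ 2) m
  set W : ℕ → ℝ := fun m => ∑ a ∈ V \ B m, x a ^ 2 with hW
  -- `z m` keeps the entries of `x` on `T` that are already selected, together with the best `m`
  -- missing ones; `W m` is the energy it drops.
  set z : ℕ → Fin N → ℝ := fun m => restr (T \ (V \ B m)) x with hz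
  have hzT : ∀ m, supp (z m) ⊆ T := fun m =>
    (supp_restr_subset _ _).trans Finset.sdiff_subset
  have hq : ∀ m, res Φ (Φ *ᵥ x + e) (z m) ≤ 3 * (e ⬝ᵥ e) + 3 / 2 * (U * W m) := fun m =>
    res_restr_sdiff_le hU hT hx (Finset.sdiff_subset.trans hVT)
  have hzB : ∀ m, supp (z m) \ S l ⊆ B m := fun m a ha => by
    obtain ⟨h1, h2⟩ := Finset.mem_sdiff.1 ha
    obtain ⟨h3, h4⟩ := Finset.mem_sdiff.1 (supp_restr_subset _ _ h1)
    by_contra h5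
    exact h4 (Finset.mem_sdiff.2 ⟨Finset.mem_sdiff.2 ⟨h3, h2⟩, h5⟩)
  -- Phase `j` runs from `p j` to `p (j + 1)` and has `κ * 2 ^ j` iterations.
  set p : ℕ → ℕ := fun j => l + κ * (2 ^ j - 1) with hp
  have hp0 : p 0 = l := by simp [hp]
  have hp1 : ∀ j, p (j + 1) = p j + κ * 2 ^ j := fun j => by
    have : 2 ^ (j + 1) - 1 = (2 ^ j - 1) + 2 ^ j := by
      have := Nat.one_le_two_pow (n := j)
      omega
    simp only [hp, this, mul_add, add_assoc]
  have hpl : ∀ j, l ≤ p j := fun j => Nat.le_add_right _ _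
  -- All phases up to `j` cost no more than the budget `A` per index for `2 ^ j / 2 + 1` newly found
  -- indices. Natural division gives 0 for `2 ^ 0 / 2`.
  have hbudget : ∀ j, p (j + 1) ≤ l + A * (2 ^ j / 2 + 1) := fun j => by
    refine Nat.add_le_add_left ?_ l
    have h1 : 2 ^ (j + 1) - 1 ≤ 4 * (2 ^ j / 2 + 1) := by
      have : 2 ^ (j + 1) = 2 * 2 ^ j := pow_succ' 2 j
      omega
    calc κ * (2 ^ (j + 1) - 1) ≤ κ * (4 * (2 ^ j / 2 + 1)) := Nat.mul_le_mul_left _ h1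
      _ = 4 * κ * (2 ^ j / 2 + 1) := by ring
      _ ≤ A * (2 ^ j / 2 + 1) := Nat.mul_le_mul_right _ hκA
  have hpM : ∀ j, 2 ^ j / 2 < t → p (j + 1) ≤ M := fun j hj =>
    (hbudget j).trans ((Nat.add_le_add_left (Nat.mul_le_mul_left A hj) l).trans hl)
  have hphase : ∀ j, 2 ^ j / 2 < t →
      R (p (j + 1)) ≤ res Φ (Φ *ᵥ x + e) (z (2 ^ j)) + 1 / 20 * R (p j) := fun j hj => by
    have h1 := hpM j hj
    have h2 : p j + κ * 2 ^ j ≤ M := by rwa [← hp1]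
    have hcard : (supp (z (2 ^ j)) \ S (p j)).card ≤ 2 ^ j :=
      (Finset.card_le_card ((Finset.sdiff_subset_sdiff le_rfl
        (hr.subset_of_le (hpl j) (by omega))).trans (hzB _))).trans (hBc _)
    have h3 := hr.res_add_le hU0 hL0 hρ hUL (fun v hv => hU v (hv.trans hs)) hL
      ((Finset.card_le_card (hzT (2 ^ j))).trans hT) hcard (by positivity) h2
    have h4 := one_sub_pow_le hρ (by positivity : 0 < 2 ^ j) hκ
    have h5 := mul_le_mul_of_nonneg_right h4 (res_nonneg Φ (Φ *ᵥ x + e) (c (p j)))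
    simp only [hR, hp1]
    linarith
  have htail : ∀ j, 2 ^ j / 2 < t → U * W (2 ^ j / 2) ≤ 128 / 49 * R (p (j + 1)) := fun j hj => by
    have h1 := hpM j hj
    have hsub : T \ S (p (j + 1)) ⊆ V :=
      Finset.sdiff_subset_sdiff le_rfl (hr.subset_of_le (hpl _) h1)
    have h2 : W (2 ^ j / 2) ≤ ∑ a ∈ T \ S (p (j + 1)), x a ^ 2 := by
      -- If more than `2 ^ j / 2` missing indices have been found, the remaining budget suffices for
      -- the induction hypothesis, contradicting `hcon`. Otherwise the found indices compete in the
      -- minimality of `B`.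
      rcases Nat.lt_or_ge (2 ^ j / 2) (V \ (T \ S (p (j + 1)))).card with h | h
      · exfalso
        have h3 := Finset.card_sdiff_add_card_eq_card hsub
        have h4 := (Nat.zero_le _).trans_lt h
        refine hcon.not_ge (IH (T \ S (p (j + 1))).card (by omega) ?_ rfl)
        calc p (j + 1) + A * (T \ S (p (j + 1))).card
            ≤ l + A * (2 ^ j / 2 + 1) + A * (T \ S (p (j + 1))).card :=
              Nat.add_le_add_right (hbudget j) _
          _ = l + A * (2 ^ j / 2 + 1 + (T \ S (p (j + 1))).card) := by ring
          _ ≤ l + A * t := Nat.add_le_add_left (Nat.mul_le_mul_left A (by omega)) l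
          _ ≤ M := hl
      · have h3 := hBmin _ _ Finset.sdiff_subset h
        rwa [Finset.sdiff_sdiff_eq_self hsub] at h3
    have h3 := hr.tail_le (T := T) hL0 hL hxs h1 (hnoise _ h1)
    have hW0 : 0 ≤ W (2 ^ j / 2) := Finset.sum_nonneg fun _ _ => sq_nonneg _
    calc U * W (2 ^ j / 2) ≤ 2 * L * W (2 ^ j / 2) := by
          gcongr
          exact hUL.trans (by gcongr)
      _ = 2 * (L * W (2 ^ j / 2)) := by ring
      _ ≤ 2 * (64 / 49 * R (p (j + 1))) := mul_le_mul_of_nonneg_left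
          ((mul_le_mul_of_nonneg_left h2 hL0.le).trans h3) zero_le_two
      _ = 128 / 49 * R (p (j + 1)) := by ring
  -- The constant 10 reproduces itself: with `R = R (p (j + 1))`, `R ≤ (3/49 + 10/20) R + (192/49) R
  -- (p (j + 2))`, which yields a factor below 9.
  have hdecay : ∀ j, 2 ^ j / 2 < t → R (p j) ≤ 10 * R (p (j + 1)) := fun j => by
    induction j with
    | zero =>
      intro hj
      have h1 := htail 0 hj
      have h2 : R (p 0) ≤ res Φ (Φ *ᵥ x + e) (z (2 ^ 0 / 2)) := by
        rw [hp0]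
        refine (hr.leastSquares l hlM).res_le fun a ha => ?_
        by_contra hS
        have h3 := hzB _ (Finset.mem_sdiff.2 ⟨ha, hS⟩)
        have h4 := Finset.card_eq_zero.1 (Nat.le_zero.1 ((hBc (2 ^ 0 / 2)).trans (by norm_num)))
        rw [h4] at h3
        simp at h3
      have h3 := hq (2 ^ 0 / 2)
      have h4 := hnoise (p 0) (by rw [hp0]; exact hlM)
      linarith
    | succ j ih =>
      intro hj
      have hj2 : 2 ^ (j + 1) / 2 = 2 ^ j := by rw [pow_succ]; simp
      have hj' : 2 ^ j / 2 < t := (Nat.div_le_self _ _).trans_lt (hj2 ▸ hj)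
      have h1 := htail (j + 1) hj
      have h2 := hphase j hj'
      have h3 := hq (2 ^ j)
      have h4 := hnoise (p (j + 1)) (hpM j hj')
      have h5 := ih hj'
      rw [hj2] at h1
      linarith
  rcases Nat.eq_zero_or_pos t with rfl | htpos
  · have h1 : supp x ⊆ S l := by
      rw [hV, Finset.card_eq_zero, Finset.sdiff_eq_empty_iff_subset] at ht
      exact hx.trans ht
    have h2 := (hr.leastSquares l hlM).res_le h1
    have h3 : res Φ (Φ *ᵥ x + e) x = e ⬝ᵥ e := by simp [res]
    have h4 := hnoise l hlM
    simp only [hR] at h4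
    linarith
  -- At the first `J` with `t ≤ 2 ^ J` the competitor drops nothing, so the residual after phase `J`
  -- is at most `3/49 + 10/20 < 1` times itself. Minimality of `J` keeps this phase within budget.
  · have hex : ∃ J, t ≤ 2 ^ J := ⟨t, Nat.lt_two_pow_self.le⟩
    have hJ := Nat.find_spec hex
    have hlt : 2 ^ Nat.find hex / 2 < t := by
      rcases h : Nat.find hex with _ | i
      · simpa using htpos
      · have := Nat.find_min hex (m := i) (by omega)
        rw [pow_succ]
        simpa using this
    set J := Nat.find hex
    have hW0 : W (2 ^ J) ≤ 0 := by
      simpa using hBmin (2 ^ J) V (Finset.Subset.refl _) (ht.le.trans hJ)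
    have h1 := hphase J hlt
    have h2 := hdecay J hlt
    have h3 := hq (2 ^ J)
    have h4 := hnoise _ (hpM J hlt)
    have h5 := mul_nonpos_of_nonneg_of_nonpos hU0.le hW0
    linarith

end IsOMPRun

/-! ### Block decompositions -/

/-- The `k` largest entries. -/
lemma exists_largest_subset {ι : Type*} [DecidableEq ι] (f : ι → ℝ) (V : Finset ι) {k : ℕ}
    (hk : 1 ≤ k) (hkV : k ≤ V.card) :
    ∃ B ⊆ V, B.card = k ∧ ∃ b, (∀ i ∈ B, b ≤ f i) ∧ ∀ i ∈ V \ B, f i ≤ b := by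
  induction k, hk using Nat.le_induction with
  | base =>
    obtain ⟨a, ha, hmax⟩ := V.exists_max_image f (Finset.card_pos.1 hkV)
    exact ⟨{a}, by simpa using ha, by simp, f a, by simp,
      fun i hi => hmax i (Finset.mem_sdiff.1 hi).1⟩
  | succ k _ ih =>
    obtain ⟨B, hBV, hBc, b, hb, hb'⟩ := ih (by omega)
    have hne : (V \ B).Nonempty := by
      rw [← Finset.card_pos]
      have := Finset.card_sdiff_add_card_eq_card hBV
      omega
    obtain ⟨a, ha, hmax⟩ := (V \ B).exists_max_image f hne
    obtain ⟨haV, haB⟩ := Finset.mem_sdiff.1 ha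
    refine ⟨insert a B, Finset.insert_subset haV hBV, by rw [Finset.card_insert_of_notMem haB, hBc],
      f a, fun i hi => ?_, fun i hi => ?_⟩
    · rcases Finset.mem_insert.1 hi with rfl | h
      · exact le_rfl
      · exact (hb' a ha).trans (hb i h)
    · rw [Finset.mem_sdiff, Finset.mem_insert, not_or] at hi
      exact hmax i (Finset.mem_sdiff.2 ⟨hi.1, hi.2.2⟩)

lemma lpNorm_two_restr_le {B : Finset (Fin N)} {x : Fin N → ℝ} {k : ℕ} {b : ℝ} (hb0 : 0 ≤ b)
    (hB : B.card ≤ k) (hb : ∀ i ∈ B, |x i| ≤ b) : lpNorm 2 (restr B x) ≤ √k * b := by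
  refine le_of_abs_le (abs_le_of_sq_le_sq ?_ (by positivity))
  rw [lpNorm_two_sq, restr_dotProduct_self, mul_pow, Real.sq_sqrt (by positivity)]
  calc ∑ i ∈ B, x i ^ 2 ≤ ∑ i ∈ B, b ^ 2 :=
        Finset.sum_le_sum fun i hi => sq_le_sq.2 (by rw [abs_of_nonneg hb0]; exact hb i hi)
    _ = B.card * b ^ 2 := by rw [Finset.sum_const, nsmul_eq_mul]
    _ ≤ k * b ^ 2 := by gcongr

/-- A subadditive functional dominated by the Euclidean norm on `k`-sparse vectors is dominated by
an `ℓ_1` norm on all vectors. -/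
lemma le_sum_abs_of_sparse_le {p : (Fin N → ℝ) → ℝ} {C : ℝ} {k : ℕ} (hk : 1 ≤ k) (hC : 0 ≤ C)
    (hadd : ∀ v w, p (v + w) ≤ p v + p w)
    (hp : ∀ v, (supp v).card ≤ k → p v ≤ C * lpNorm 2 v) {x : Fin N → ℝ} {V : Finset (Fin N)}
    {b : ℝ} (hb0 : 0 ≤ b) (hb : ∀ i ∈ V, |x i| ≤ b) :
    p (restr V x) ≤ C * (√k * b + (∑ i ∈ V, |x i|) / √k) := by
  have hk0 : (0 : ℝ) < k := by exact_mod_cast hk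
  induction hV : V.card using Nat.strong_induction_on generalizing V b with
  | _ v IH =>
  have hblock : ∀ B ⊆ V, B.card ≤ k → p (restr B x) ≤ C * (√k * b) := fun B hB hBk =>
    (hp _ ((Finset.card_le_card (supp_restr_subset B x)).trans hBk)).trans
      (mul_le_mul_of_nonneg_left
        (lpNorm_two_restr_le hb0 hBk fun i hi => hb i (hB hi)) hC)
  rcases le_total V.card k with h | h
  · refine (hblock V (Finset.Subset.refl _) h).trans (mul_le_mul_of_nonneg_left ?_ hC)
    exact le_add_of_nonneg_right (by positivity)
  · obtain ⟨B, hBV, hBc, b', h1, h2⟩ := exists_largest_subset (fun i => |x i|) V hk h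
    have hcard := Finset.card_sdiff_add_card_eq_card hBV
    -- The entries after block `B` are bounded by its smallest one, hence by its average. The
    -- threshold `b'` is not known to be nonnegative, hence `max b' 0`.
    have h3 : √k * (max b' 0) ≤ (∑ i ∈ B, |x i|) / √k := by
      rw [le_div_iff₀ (by positivity), mul_right_comm, Real.mul_self_sqrt hk0.le, ← hBc,
        ← nsmul_eq_mul]
      exact Finset.card_nsmul_le_sum _ _ _ fun i hi => max_le (h1 i hi) (abs_nonneg _)
    have h4 := IH _ (by omega) (V := V \ B) (le_max_right b' 0)
      (fun i hi => (h2 i hi).trans (le_max_left _ _)) rfl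
    rw [← restr_add_restr_sdiff hBV x, ← Finset.sum_sdiff hBV]
    calc p (restr B x + restr (V \ B) x) ≤ p (restr B x) + p (restr (V \ B) x) := hadd _ _
      _ ≤ C * (√k * b) + C * (√k * (max b' 0) + (∑ i ∈ V \ B, |x i|) / √k) :=
          add_le_add (hblock B hBV hBc.le) h4
      _ ≤ C * (√k * b) + C * ((∑ i ∈ B, |x i|) / √k + (∑ i ∈ V \ B, |x i|) / √k) := by gcongr
      _ = _ := by ring

lemma bestTermError_nonneg (k : ℕ) (p : ℝ≥0∞) [Fact (1 ≤ p)] (x : Fin N → ℝ) :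
    0 ≤ bestTermError k p x :=
  Real.sInf_nonneg (by rintro _ ⟨z, _, rfl⟩; exact norm_nonneg _)

/-- For a sparse `z`, the part of `x - z` off `supp z` is that of `x`, so the best index set does at
least as well as any `z`. -/
lemma exists_sum_compl_le_bestTermError (k : ℕ) (x : Fin N → ℝ) :
    ∃ B : Finset (Fin N), B.card ≤ k ∧ ∑ i ∈ Finset.univ \ B, |x i| ≤ bestTermError k 1 x := by
  obtain ⟨B, -, hB, hmin⟩ := exists_min_tail Finset.univ (fun i => |x i|) k
  refine ⟨B, hB, le_csInf ⟨_, 0, by simp [sparseVectors, supp], rfl⟩ ?_⟩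
  rintro _ ⟨z, hz, rfl⟩
  refine (hmin (supp z) (Finset.subset_univ _) hz).trans ?_
  simp only [lpNorm_one_eq]
  calc ∑ i ∈ Finset.univ \ supp z, |x i| = ∑ i ∈ Finset.univ \ supp z, |(x - z) i| := by
        refine Finset.sum_congr rfl fun i hi => ?_
        simp [notMem_supp.1 (Finset.mem_sdiff.1 hi).2]
    _ ≤ ∑ i, |(x - z) i| :=
        Finset.sum_le_sum_of_subset_of_nonneg (Finset.subset_univ _) fun _ _ _ => abs_nonneg _

/-- Off a suitable set of `2k` indices, every functional dominated by the Euclidean norm on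
`k`-sparse vectors is dominated by the best `k`-term approximation error in `ℓ_1`. -/
lemma exists_restr_compl_le (x : Fin N → ℝ) {k : ℕ} (hk : 1 ≤ k) :
    ∃ T : Finset (Fin N), T.card ≤ 2 * k ∧ ∀ (p : (Fin N → ℝ) → ℝ) (C : ℝ), 0 ≤ C →
      (∀ v w, p (v + w) ≤ p v + p w) → (∀ v, (supp v).card ≤ k → p v ≤ C * lpNorm 2 v) →
      p (restr (Finset.univ \ T) x) ≤ C * (bestTermError k 1 x / √k) := by
  have hk0 : (0 : ℝ) < k := by exact_mod_cast hk
  obtain ⟨B, hBk, hB⟩ := exists_sum_compl_le_bestTermError k x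
  set V := Finset.univ \ B with hV
  rcases le_total V.card k with h | h
  · refine ⟨Finset.univ, ?_, fun p C hC _ hp => ?_⟩
    · have := Finset.card_sdiff_add_card_eq_card (Finset.subset_univ B)
      rw [← hV] at this
      omega
    · have h1 := hp 0 (by simp [supp])
      rw [lpNorm_two_zero, mul_zero] at h1
      rw [Finset.sdiff_self, restr_empty]
      exact h1.trans (mul_nonneg hC (div_nonneg (bestTermError_nonneg k 1 x) (Real.sqrt_nonneg _)))
  · obtain ⟨B', hBV, hBc, b, h1, h2⟩ := exists_largest_subset (fun i => |x i|) V hk h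
    -- The second block `B'` goes into `T` so that its `ℓ_1` mass controls the first block of the
    -- remainder.
    refine ⟨B ∪ B', (Finset.card_union_le _ _).trans (by omega), fun p C hC hadd hp => ?_⟩
    have h3 : √k * (max b 0) ≤ (∑ i ∈ B', |x i|) / √k := by
      rw [le_div_iff₀ (by positivity), mul_right_comm, Real.mul_self_sqrt hk0.le, ← hBc,
        ← nsmul_eq_mul]
      exact Finset.card_nsmul_le_sum _ _ _ fun i hi => max_le (h1 i hi) (abs_nonneg _)
    have h4 := le_sum_abs_of_sparse_le hk hC hadd hp (x := x) (V := V \ B') (le_max_right b 0)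
      (fun i hi => (h2 i hi).trans (le_max_left _ _))
    rw [show Finset.univ \ (B ∪ B') = V \ B' by ext; simp [hV]]
    refine h4.trans (mul_le_mul_of_nonneg_left ?_ hC)
    rw [← Finset.sum_sdiff hBV] at hB
    calc √k * max b 0 + (∑ i ∈ V \ B', |x i|) / √k
        ≤ (∑ i ∈ B', |x i|) / √k + (∑ i ∈ V \ B', |x i|) / √k := by gcongr
      _ = (∑ i ∈ V \ B', |x i| + ∑ i ∈ B', |x i|) / √k := by ring
      _ ≤ _ := by gcongr

/-! ### Instance optimality -/

/-- The error of orthogonal matching pursuit is bounded by the best `k`-term approximation error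
in `ℓ_1`. -/
theorem IsOMPOutput.lpNorm_sub_le {k A κ : ℕ} (hk : 1 ≤ k) {Φ : Matrix (Fin n) (Fin N) ℝ}
    {U L ρ : ℝ} (hU0 : 0 < U) (hL0 : 0 < L) (hρ : 1 ≤ ρ) (hρ2 : ρ ≤ 2) (hUL : U ≤ ρ * L)
    (hU : ∀ v : Fin N → ℝ, (supp v).card ≤ 2 * k → (Φ *ᵥ v) ⬝ᵥ (Φ *ᵥ v) ≤ U * (v ⬝ᵥ v))
    (hL : ∀ v : Fin N → ℝ, (supp v).card ≤ A * (2 * k) + 2 * k →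
      L * (v ⬝ᵥ v) ≤ (Φ *ᵥ v) ⬝ᵥ (Φ *ᵥ v))
    (hκ : 3 * ρ ≤ κ) (hκA : 4 * κ ≤ A) {x b : Fin N → ℝ}
    (hb : IsOMPOutput Φ (A * (2 * k)) (Φ *ᵥ x) b) :
    lpNorm 2 (b - x) ≤ (8 * ρ + 1) * (bestTermError k 1 x / √k) := by
  obtain ⟨S', hS'⟩ := hb
  obtain ⟨T, hT, hblock⟩ := exists_restr_compl_le x hk
  set σ := bestTermError k 1 x / √k with hσ
  set u := restr T x with hu
  set w := restr (Finset.univ \ T) x with hw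
  have hxuw : u + w = x := by
    rw [hu, hw, restr_add_restr_sdiff (Finset.subset_univ T)]
    ext i; simp [restr]
  have hy : Φ *ᵥ x = Φ *ᵥ u + Φ *ᵥ w := by rw [← Matrix.mulVec_add, hxuw]
  rw [hy] at hS'
  obtain ⟨S, c, hr, rfl, rfl⟩ := hS'.exists_run
  set M := A * (2 * k) with hM
  have hσ0 : 0 ≤ σ := div_nonneg (bestTermError_nonneg k 1 x) (Real.sqrt_nonneg _)
  have hw2 : lpNorm 2 w ≤ σ := by
    have := hblock (lpNorm 2) 1 zero_le_one lpNorm_two_add_le fun v _ => (one_mul _).ge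
    rwa [one_mul] at this
  have he : lpNorm 2 (Φ *ᵥ w) ≤ √U * σ := by
    refine hblock (fun v => lpNorm 2 (Φ *ᵥ v)) (√U) (Real.sqrt_nonneg U) (fun v v' => ?_)
      fun v hv => ?_
    · simp only [Matrix.mulVec_add]
      exact lpNorm_two_add_le _ _
    · refine le_of_abs_le (abs_le_of_sq_le_sq ?_ (mul_nonneg (Real.sqrt_nonneg U) (lpNorm_two_nonneg v)))
      rw [mul_pow, Real.sq_sqrt hU0.le, lpNorm_two_sq, lpNorm_two_sq]
      exact hU v (by omega)
  have hres := hr.res_le (l := 0) hU0 hL0 hρ hρ2 hUL (by omega) hU hL hT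
    (supp_restr_subset T x) hκ hκA (by
      rw [zero_add]
      exact Nat.mul_le_mul_left A ((Finset.card_le_card Finset.sdiff_subset).trans hT))
  have hres2 : lpNorm 2 (Φ *ᵥ u + Φ *ᵥ w - Φ *ᵥ c M) ≤ 7 * lpNorm 2 (Φ *ᵥ w) := by
    refine le_of_abs_le (abs_le_of_sq_le_sq ?_ (mul_nonneg (by norm_num) (lpNorm_two_nonneg _)))
    rw [mul_pow, lpNorm_two_sq, lpNorm_two_sq]
    rw [res] at hres
    linarith
  have hdiff : lpNorm 2 (Φ *ᵥ (u - c M)) ≤ 8 * (√U * σ) := by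
    have h1 : Φ *ᵥ (u - c M) = (Φ *ᵥ u + Φ *ᵥ w - Φ *ᵥ c M) + -(Φ *ᵥ w) := by
      rw [Matrix.mulVec_sub]; abel
    have h2 := lpNorm_two_add_le (Φ *ᵥ u + Φ *ᵥ w - Φ *ᵥ c M) (-(Φ *ᵥ w))
    rw [lpNorm_two_neg, ← h1] at h2
    linarith
  have hmain : lpNorm 2 (u - c M) ≤ 8 * ρ * σ := by
    refine le_of_abs_le (abs_le_of_sq_le_sq ?_ (by positivity))
    have h1 := hL (u - c M) (by
      have h3 := Finset.card_le_card (supp_sub_subset u (c M))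
      have h4 := Finset.card_union_le (supp u) (supp (c M))
      have h5 := Finset.card_le_card (hr.leastSquares M le_rfl).1
      have h6 := hr.card_le (l := M) le_rfl
      have h7 : (supp u).card ≤ T.card := Finset.card_le_card (supp_restr_subset T x)
      omega)
    rw [← lpNorm_two_sq, ← lpNorm_two_sq] at h1
    have h2 := pow_le_pow_left₀ (lpNorm_two_nonneg _) hdiff 2
    have h3 : (8 * (√U * σ)) ^ 2 = 64 * (U * σ ^ 2) := by
      rw [mul_pow, mul_pow, Real.sq_sqrt hU0.le]; ring
    refine le_of_mul_le_mul_left ?_ hL0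
    calc L * lpNorm 2 (u - c M) ^ 2 ≤ 64 * (U * σ ^ 2) := by linarith
      _ ≤ 64 * ((ρ * L) * σ ^ 2) := by gcongr
      _ = ρ * (64 * L * σ ^ 2) := by ring
      -- Replacing `√ρ` by `ρ ≥ 1` in the final bound is affordable.
      _ ≤ ρ ^ 2 * (64 * L * σ ^ 2) := by
          gcongr
          nlinarith
      _ = L * (8 * ρ * σ) ^ 2 := by ring
  have hsplit : c M - x = -((u - c M) + w) := by rw [← hxuw]; abel
  rw [hsplit, lpNorm_two_neg]
  have := lpNorm_two_add_le (u - c M) w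
  linarith

end OMP

/-! ### The corollary -/

theorem mainTheorem2 (n N k : ℕ) (hk : 1 ≤ k) (Φ : Matrix (Fin n) (Fin N) ℝ)
    (δ : ℝ) (hδ0 : 0 < δ) (hδ1 : δ ≤ 1)
    (α : ℕ) (hα : α = ⌈16 + 15 * δ⌉₊)
    (hRIP : OMP.ripConst Φ (2 * k) + (1 + δ) * OMP.ripConst Φ (2 * α * k) ≤ δ)
    (C₂ : ℝ) (hC₂ : C₂ = 2 * (1 + δ) * (√(11 + 20 * δ) + 1) + 3) :
    (∀ x xstar : Fin N → ℝ, OMP.IsOMPOutput Φ (2 * (α - 1) * k) (Φ *ᵥ x) xstar →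
      OMP.lpNorm 2 (xstar - x) ≤ C₂ * OMP.bestTermError k 1 x / √(k : ℝ)) ∧
    (∀ Δ : (Fin n → ℝ) → (Fin N → ℝ), OMP.IsOMPDecoder Φ (2 * (α - 1) * k) Δ →
      OMP.InstanceOptimal Φ Δ 2 1 k C₂) := by
  have hmain : ∀ x xstar : Fin N → ℝ, OMP.IsOMPOutput Φ (2 * (α - 1) * k) (Φ *ᵥ x) xstar →
      OMP.lpNorm 2 (xstar - x) ≤ C₂ * (OMP.bestTermError k 1 x / √(k : ℝ)) := by
    intro x xstar hx
    have ha0 := OMP.ripConst_nonneg Φ (2 * k)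
    have hd0 := OMP.ripConst_nonneg Φ (2 * α * k)
    have ha := OMP.ripWith_ripConst Φ (2 * k)
    have hd := OMP.ripWith_ripConst Φ (2 * α * k)
    set a := OMP.ripConst Φ (2 * k)
    set d := OMP.ripConst Φ (2 * α * k)
    have hα16 : 16 + 15 * δ ≤ α := hα ▸ Nat.le_ceil _
    have hα1 : 16 ≤ α := by
      have : (16 : ℝ) ≤ α := by linarith
      exact_mod_cast this
    -- With `A = α - 1` and `κ = ⌊A / 4⌋`, rounding gives `κ ≥ (α - 4) / 4 ≥ 3 + 15 δ / 4`; this is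
    -- where the size of `α` is used.
    have hκ : 3 * (1 + δ) ≤ (((α - 1) / 4 : ℕ) : ℝ) := by
      have h1 : α ≤ 4 * ((α - 1) / 4) + 4 := by omega
      have h2 : (α : ℝ) ≤ 4 * (((α - 1) / 4 : ℕ) : ℝ) + 4 := by exact_mod_cast h1
      linarith
    have hd1 : d < 1 := by nlinarith
    have hM : 2 * (α - 1) * k = (α - 1) * (2 * k) := by ring
    have hM2 : (α - 1) * (2 * k) + 2 * k = 2 * α * k := by
      obtain ⟨b, rfl⟩ : ∃ b, α = b + 1 := ⟨α - 1, by omega⟩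
      simp only [Nat.add_sub_cancel]
      ring
    rw [hM] at hx
    have h := OMP.IsOMPOutput.lpNorm_sub_le (U := 1 + a) (L := 1 - d) (ρ := 1 + δ) hk
      (by linarith) (by linarith) (by linarith) (by linarith) (by linarith)
      (fun v hv => by simpa only [OMP.lpNorm_two_sq] using (ha v hv).2)
      (fun v hv => by
        rw [hM2] at hv
        simpa only [OMP.lpNorm_two_sq] using (hd v hv).1)
      hκ (by omega) hx
    refine h.trans (mul_le_mul_of_nonneg_right ?_
      (div_nonneg (OMP.bestTermError_nonneg k 1 x) (Real.sqrt_nonneg _)))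
    -- Then `C₂ ≥ 2 (1 + δ) * 4 + 3`, which exceeds `8ρ + 1`.
    have h3 : 3 ≤ √(11 + 20 * δ) := Real.le_sqrt_of_sq_le (by linarith)
    rw [hC₂]
    nlinarith
  refine ⟨fun x xstar hx => ?_, fun Δ hΔ x => ?_⟩
  · rw [mul_div_assoc]
    exact hmain x xstar hx
  · have h := hmain x _ (hΔ (Φ *ᵥ x))
    rw [← OMP.lpNorm_two_neg, neg_sub, Real.sqrt_eq_rpow] at h
    convert h using 4
    norm_num
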